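/- Let $\mathcal M$ be a compact (Hausdorff) topological manifold without boundary, of dimension $d$, let $R:\mathcal M\to\mathcal M$ be a homeomorphism, let $\mu$ be an $R$-invariant Borel probability measure on $\mathcal M$ which is aperiodic (that is, the set of periodic points of $R$ has $\mu$-measure $0$), and let $A\subset\mathcal M$ be a Borel set with $\mu(A)>0$. Then for every $\varepsilon>0$ there exists a Cantor set $K\subset A$ (a non-empty metrisable totally disconnected compact set without isolated points) such that: 1. $K$ is dynamically coherent for $R$: for each $k\in\mathbb Z$ the set $R^k(K)\cap K$ is open in $K$; and for every integer $p\ge 0$ and every $x\in K$ there are integers $k,\ell\ge 1$ such that none of the points $R^{k}(x),\dots,R^{k+p}(x)$ and $R^{-\ell}(x),\dots,R^{-\ell-p}(x)$ lies in $K$; 2. $K\cap R(K)=\emptyset$; 3. $K$ is tamely embedded: every open set containing $K$ contains a neighbourhood of $K$ which is a finite union of pairwise disjoint subsets of $\mathcal M$, each homeomorphic to the closed unit ball of $\mathbb R^d$; 4. $K$ is dynamically meagre for $R$: $K$ has empty interior in $\Lambda=\mathrm{Cl}\left(\bigcup_{i\in\mathbb Z}R^i(K)\right)$; 5. $\left|\mu\left(\bigcup_{k\in\mathbb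 Z}R^k(A)\right)-\mu\left(\bigcup_{k\in\mathbb Z}R^k(K)\right)\right|<\varepsilon$, and $\mu(K)>0$. -/

import Mathlib

/-- `K` is a Cantor set: nonempty, metrisable, compact, totally disconnected, and without
isolated points (every point of `K` is an accumulation point of `K`). -/
structure IsCantorSet {M : Type*} [TopologicalSpace M] (K : Set M) : Prop where
  nonempty : K.Nonempty
  metrizable : TopologicalSpace.MetrizableSpace K
  isCompact : IsCompact K
  isTotallyDisconnected : IsTotallyDisconnected K
  preperfect : Preperfect K

/-- A rectangle of a `d`-dimensional manifold: a subset homeomorphic to the closed unit ball of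
`ℝᵈ`. -/
def IsRectangle (d : ℕ) {M : Type*} [TopologicalSpace M] (X : Set M) : Prop :=
  Nonempty (X ≃ₜ Metric.closedBall (0 : EuclideanSpace ℝ (Fin d)) 1)

/-- `K` is tamely embedded: it has arbitrarily small neighbourhoods that are finite unions of
pairwise disjoint rectangles. -/
def IsTamelyEmbedded (d : ℕ) {M : Type*} [TopologicalSpace M] (K : Set M) : Prop :=
  ∀ U : Set M, IsOpen U → K ⊆ U →
    ∃ E : Set (Set M), E.Finite ∧ (∀ X ∈ E, IsRectangle d X) ∧ E.PairwiseDisjoint id ∧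
      K ⊆ interior (⋃₀ E) ∧ ⋃₀ E ⊆ U

/-- `K` is dynamically coherent for `R`: each `R^k(K) ∩ K` is open in `K`, and every point of `K`
has arbitrarily long runs of consecutive positive iterates, and of consecutive negative iterates,
outside `K`. -/
structure IsDynamicallyCoherent {M : Type*} [TopologicalSpace M] (R : M ≃ₜ M) (K : Set M) :
    Prop where
  isOpen_inter : ∀ k : ℤ, IsOpen ((↑) ⁻¹' ((R ^ k) '' K ∩ K) : Set K)
  exists_forward : ∀ p : ℕ, ∀ x ∈ K, ∃ k : ℕ, 1 ≤ k ∧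
    ∀ j : ℕ, j ≤ p → (R ^ ((k : ℤ) + j)) x ∉ K
  exists_backward : ∀ p : ℕ, ∀ x ∈ K, ∃ l : ℕ, 1 ≤ l ∧
    ∀ j : ℕ, j ≤ p → (R ^ (-(l : ℤ) - j)) x ∉ K

/-- The saturation `⋃ₖ R^k(K)`, `k ∈ ℤ`. -/
def orbitSaturation {M : Type*} [TopologicalSpace M] (R : M ≃ₜ M) (K : Set M) : Set M :=
  ⋃ k : ℤ, (R ^ k) '' K

/-- `K` is dynamically meagre for `R`: it has empty interior in the closure `Λ` of `⋃ₖ R^k(K)`,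
for the subspace topology of `Λ`. -/
def IsDynamicallyMeagre {M : Type*} [TopologicalSpace M] (R : M ≃ₜ M) (K : Set M) : Prop :=
  interior ((↑) ⁻¹' K : Set (closure (orbitSaturation R K))) = ∅

open MeasureTheory Set Filter Topology
open scoped ENNReal

/-! ### Orbits, sweeping subsets and recurrence. -/

section Dynamics

variable {M : Type*} [TopologicalSpace M]

/-! Every property of `K` is bought by deleting a set of small measure. Aperiodicity gives
(`exists_small_sweeping_subset`) a set `A₀ ⊆ A` disjoint from its image, with the same saturation up
to a null set; deleting little from `A₀` then changes the saturation little
(`exists_forall_measure_orbitSaturation_diff_lt`).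

Three small sets are removed. `exists_markers`: rare markers `C m` with their first `m` iterates,
which leave long gaps in the orbit of every remaining point. `exists_small_set_recurrent`: small
sweeping pieces of all basic open sets; almost every orbit comes back near its starting point inside
them, hence outside `K`, which makes `K` meagre. `exists_small_set_compl_rectangles`: what finite
families of disjoint small rectangles miss at each scale; this gives tameness and total
disconnectedness.

The delicate point is to have `K` closed with `R^k(K) ∩ K` open in `K`
(`exists_isClosed_coherent_subset`). At stage `m`, regularity of `μ` describes the visits to the
current set by closed sets, off a small bad set. Not only the bad set is deleted, but every orbit
block between visits to `C m` that meets it. Points of the set at most `m` steps apart lie in one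
block, so both survive or neither does: visits at times `|k| ≤ m` are frozen from stage `m` on, and
their closed description passes to the limit. Finally, restricting to the support of the measure on
`K` removes isolated points, since `μ` has no atoms. -/

theorem Homeomorph.zpow_add_apply (R : M ≃ₜ M) (a b : ℤ) (x : M) :
    (R ^ (a + b)) x = (R ^ a) ((R ^ b) x) := by
  rw [zpow_add]; rfl

theorem Homeomorph.zpow_natCast_apply (R : M ≃ₜ M) (n : ℕ) (x : M) :
    (R ^ (n : ℤ)) x = R^[n] x := by
  induction n generalizing x with
  | zero => simp
  | succ n ih =>
    rw [Nat.cast_succ, R.zpow_add_apply, zpow_one, ih, Function.iterate_succ_apply]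

theorem Homeomorph.zpow_neg_natCast_apply (R : M ≃ₜ M) (n : ℕ) (x : M) :
    (R ^ (-(n : ℤ))) x = R.symm^[n] x := by
  rw [← Homeomorph.zpow_natCast_apply R.symm, zpow_neg, ← inv_zpow]
  rfl

theorem Homeomorph.zpow_neg_zpow_apply (R : M ≃ₜ M) (k : ℤ) (x : M) :
    (R ^ (-k)) ((R ^ k) x) = x := by
  rw [← R.zpow_add_apply]; simp

theorem Homeomorph.zpow_zpow_neg_apply (R : M ≃ₜ M) (k : ℤ) (x : M) :
    (R ^ k) ((R ^ (-k)) x) = x := by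
  rw [← R.zpow_add_apply]; simp

theorem Homeomorph.mem_zpow_image_iff (R : M ≃ₜ M) (k : ℤ) (S : Set M) (x : M) :
    x ∈ (R ^ k) '' S ↔ (R ^ (-k)) x ∈ S := by
  constructor
  · rintro ⟨y, hy, rfl⟩
    rwa [R.zpow_neg_zpow_apply]
  · exact fun h => ⟨_, h, R.zpow_zpow_neg_apply k x⟩

theorem mem_orbitSaturation_iff (R : M ≃ₜ M) (S : Set M) (x : M) :
    x ∈ orbitSaturation R S ↔ ∃ k : ℤ, (R ^ k) x ∈ S := by
  simp only [orbitSaturation, mem_iUnion, R.mem_zpow_image_iff]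
  exact ⟨fun ⟨k, h⟩ => ⟨-k, h⟩, fun ⟨k, h⟩ => ⟨-k, by rwa [neg_neg]⟩⟩

theorem zpow_mem_orbitSaturation_iff (R : M ≃ₜ M) (S : Set M) (k : ℤ) (x : M) :
    (R ^ k) x ∈ orbitSaturation R S ↔ x ∈ orbitSaturation R S := by
  simp only [mem_orbitSaturation_iff, ← R.zpow_add_apply]
  exact ⟨fun ⟨j, h⟩ => ⟨j + k, h⟩, fun ⟨j, h⟩ => ⟨j - k, by rwa [sub_add_cancel]⟩⟩

theorem orbitSaturation_mono (R : M ≃ₜ M) {S T : Set M} (h : S ⊆ T) :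
    orbitSaturation R S ⊆ orbitSaturation R T :=
  iUnion_mono fun _ => image_mono h

/-- Every point that is not periodic has a neighbourhood disjoint from its first `N` iterates. -/
theorem exists_isOpen_iterate_notMem [T2Space M] (R : M ≃ₜ M) (N : ℕ) {x : M}
    (hx : x ∉ Function.periodicPts R) :
    ∃ U, IsOpen U ∧ x ∈ U ∧ ∀ j ∈ Finset.Icc 1 N, ∀ y ∈ U, (R ^ (j : ℤ)) y ∉ U := by
  have key : ∀ j ∈ Finset.Icc 1 N, ∃ U, IsOpen U ∧ x ∈ U ∧ ∀ y ∈ U, (R ^ (j : ℤ)) y ∉ U := by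
    intro j hj
    have hne : (R ^ (j : ℤ)) x ≠ x := fun h => hx
      ⟨j, (Finset.mem_Icc.1 hj).1, by rwa [R.zpow_natCast_apply] at h⟩
    obtain ⟨V, W, hV, hW, hxV, hxW, hd⟩ := t2_separation hne
    exact ⟨W ∩ (R ^ (j : ℤ)) ⁻¹' V, hW.inter (hV.preimage (R ^ (j : ℤ)).continuous), ⟨hxW, hxV⟩,
      fun y hy hy' => hd.le_bot ⟨hy.2, hy'.1⟩⟩
  choose! U hU hxU hUd using key
  refine ⟨⋂ j ∈ Finset.Icc 1 N, U j, isOpen_biInter_finset hU, mem_iInter₂.2 hxU, ?_⟩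
  intro j hj y hy hy'
  exact hUd j hj y (mem_iInter₂.1 hy j hj) (mem_iInter₂.1 hy' j hj)

variable [MeasurableSpace M] [BorelSpace M]

theorem measurable_zpow (R : M ≃ₜ M) (k : ℤ) : Measurable (R ^ k) :=
  (R ^ k).continuous.measurable

theorem MeasurableSet.orbitSaturation {R : M ≃ₜ M} {S : Set M} (hS : MeasurableSet S) :
    MeasurableSet (orbitSaturation R S) := by
  have : _root_.orbitSaturation R S = ⋃ k : ℤ, (R ^ k) ⁻¹' S := by
    ext x; simp [mem_orbitSaturation_iff]
  rw [this]
  exact .iUnion fun k => measurable_zpow R k hS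

/-- A measurable set contains a measurable subset disjoint from its first `N` iterates that meets
the orbit of each of its non-periodic points. -/
theorem exists_sweeping_subset [T2Space M] [SecondCountableTopology M] (R : M ≃ₜ M) {A : Set M}
    (hA : MeasurableSet A) (N : ℕ) :
    ∃ C ⊆ A, MeasurableSet C ∧ (∀ j ∈ Finset.Icc 1 N, ∀ x ∈ C, (R ^ (j : ℤ)) x ∉ C) ∧
      A \ Function.periodicPts R ⊆ orbitSaturation R C := by
  classical
  obtain ⟨b, hbc, -, hb⟩ := TopologicalSpace.exists_countable_basis M
  let good : Set (Set M) :=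
    {U | IsOpen U ∧ ∀ j ∈ Finset.Icc 1 N, ∀ y ∈ U, (R ^ (j : ℤ)) y ∉ U}
  have hgood : (b ∩ good ∪ {∅}).Countable :=
    (hbc.mono inter_subset_left).union (countable_singleton _)
  obtain ⟨U, hU⟩ := hgood.exists_eq_range ⟨∅, Or.inr rfl⟩
  have hUgood : ∀ n, U n ∈ good := by
    intro n
    have : U n ∈ b ∩ good ∪ {∅} := hU ▸ mem_range_self n
    rcases this with h | h
    · exact h.2
    · rw [mem_singleton_iff.1 h]; exact ⟨isOpen_empty, by simp⟩
  let S : ℕ → Set M := fun n => A ∩ U n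
  have hS : ∀ n, MeasurableSet (S n) := fun n => hA.inter (hUgood n).1.measurableSet
  -- Each orbit keeps only the first `S n` that it meets. Two kept points of one orbit thus lie in
  -- the same `U n`, which excludes return times from 1 to `N`.
  let D : ℕ → Set M := fun n => S n \ ⋃ i, ⋃ (_ : i < n), orbitSaturation R (S i)
  have hD : ∀ n x, x ∈ D n ↔ x ∈ S n ∧ ∀ i < n, x ∉ orbitSaturation R (S i) := by
    intro n x; simp [D]
  refine ⟨⋃ n, D n, iUnion_subset fun n x hx => hx.1.1, ?_, ?_, ?_⟩
  · exact .iUnion fun n => (hS n).diff (.iUnion fun i => .iUnion fun _ => (hS i).orbitSaturation)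
  · intro j hj x hx hx'
    obtain ⟨n, hn⟩ := mem_iUnion.1 hx
    obtain ⟨m, hm⟩ := mem_iUnion.1 hx'
    rw [hD] at hn hm
    rcases lt_trichotomy n m with h | h | h
    · refine hm.2 n h ((zpow_mem_orbitSaturation_iff _ _ _ _).2 ?_)
      exact (mem_orbitSaturation_iff _ _ _).2 ⟨0, by simpa using hn.1⟩
    · subst h
      exact (hUgood n).2 j hj x hn.1.2 hm.1.2
    · exact hn.2 m h ((mem_orbitSaturation_iff _ _ _).2 ⟨j, hm.1⟩)
  · rintro x ⟨hxA, hxp⟩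
    have hex : ∃ n, x ∈ orbitSaturation R (S n) := by
      obtain ⟨V, hV, hxV, hVd⟩ := exists_isOpen_iterate_notMem R N hxp
      obtain ⟨W, hWb, hxW, hWV⟩ := hb.exists_subset_of_mem_open hxV hV
      have hW : W ∈ range U := hU ▸ Or.inl ⟨hWb, hb.isOpen hWb,
        fun j hj y hy hy' => hVd j hj y (hWV hy) (hWV hy')⟩
      obtain ⟨n, rfl⟩ := hW
      exact ⟨n, (mem_orbitSaturation_iff _ _ _).2 ⟨0, by simpa using ⟨hxA, hxW⟩⟩⟩
    obtain ⟨k, hk⟩ := (mem_orbitSaturation_iff _ _ _).1 (Nat.find_spec hex)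
    refine (mem_orbitSaturation_iff _ _ _).2 ⟨k, mem_iUnion.2 ⟨Nat.find hex, ?_⟩⟩
    rw [hD]
    exact ⟨hk, fun i hi h => Nat.find_min hex hi ((zpow_mem_orbitSaturation_iff _ _ _ _).1 h)⟩

variable {R : M ≃ₜ M} {μ : Measure M}

theorem MeasureTheory.MeasurePreserving.zpow (hinv : MeasurePreserving R μ μ) (k : ℤ) :
    MeasurePreserving (R ^ k) μ μ := by
  have hsymm : MeasurePreserving R.symm μ μ :=
    MeasurePreserving.symm R.toMeasurableEquiv hinv
  obtain ⟨n, rfl | rfl⟩ := k.eq_nat_or_neg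
  · have h := hinv.iterate n
    rwa [← show ⇑(R ^ (n : ℤ)) = R^[n] from funext (R.zpow_natCast_apply n)] at h
  · have h := hsymm.iterate n
    rwa [← show ⇑(R ^ (-(n : ℤ))) = R.symm^[n] from funext (R.zpow_neg_natCast_apply n)] at h

theorem measure_zpow_preimage (hinv : MeasurePreserving R μ μ) (k : ℤ) (S : Set M) :
    μ ((R ^ k) ⁻¹' S) = μ S :=
  (hinv.zpow k).measure_preimage_equiv (f := (R ^ k).toMeasurableEquiv) S

theorem measure_biUnion_zpow_preimage_le (hinv : MeasurePreserving R μ μ) (n : ℕ) (D : Set M) :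
    μ (⋃ k ∈ Finset.Icc (-(n : ℤ)) n, (R ^ k) ⁻¹' D) ≤ μ D * (2 * n + 1) := by
  have hcard : ((Finset.Icc (-(n : ℤ)) n).card : ℝ≥0∞) = 2 * n + 1 := by
    rw [Int.card_Icc, show ((n : ℤ) + 1 - -(n : ℤ)).toNat = 2 * n + 1 by omega]
    push_cast; ring
  refine (measure_biUnion_finset_le _ _).trans ?_
  simp only [measure_zpow_preimage hinv, Finset.sum_const, nsmul_eq_mul, hcard]
  rw [mul_comm]

/-- By Poincaré recurrence an atom would return to itself, hence be periodic. -/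
theorem measure_singleton_eq_zero_of_aperiodic [T1Space M] [IsFiniteMeasure μ]
    (hinv : MeasurePreserving R μ μ) (haper : μ (Function.periodicPts R) = 0) (x : M) :
    μ {x} = 0 := by
  by_contra h
  obtain ⟨y, hy, m, hm, hmy⟩ :=
    hinv.conservative.exists_mem_iterate_mem (measurableSet_singleton x).nullMeasurableSet h
  rw [mem_singleton_iff] at hy hmy
  subst hy
  exact h (measure_mono_null (singleton_subset_iff.2 (Function.mk_mem_periodicPts
    (Nat.pos_of_ne_zero hm) hmy)) haper)

/-- The preimages of `C` under `R^j`, `j < N`, are pairwise disjoint and have equal measure. -/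
theorem measure_le_inv_of_disjoint_iterates [IsProbabilityMeasure μ]
    (hinv : MeasurePreserving R μ μ) {C : Set M} (hC : MeasurableSet C) {N : ℕ}
    (hd : ∀ j ∈ Finset.Icc 1 N, ∀ x ∈ C, (R ^ (j : ℤ)) x ∉ C) :
    μ C ≤ ((N : ℝ≥0∞))⁻¹ := by
  have hdisj : (↑(Finset.range N) : Set ℕ).PairwiseDisjoint fun j : ℕ => (R ^ (j : ℤ)) ⁻¹' C := by
    have aux : ∀ i j : ℕ, i < j → j < N →
        Disjoint ((R ^ (i : ℤ)) ⁻¹' C) ((R ^ (j : ℤ)) ⁻¹' C) := by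
      intro i j hij hj
      refine disjoint_left.2 fun x hx hx' => ?_
      refine hd (j - i) (Finset.mem_Icc.2 ⟨by omega, by omega⟩) _ hx ?_
      rw [← R.zpow_add_apply, show ((j - i : ℕ) : ℤ) + i = j by omega]
      exact hx'
    intro i hi j hj hne
    rw [Finset.coe_range, mem_Iio] at hi hj
    rcases lt_or_gt_of_ne hne with h | h
    · exact aux i j h hj
    · exact (aux j i h hi).symm
  have hsum : ∑ j ∈ Finset.range N, μ ((R ^ (j : ℤ)) ⁻¹' C) ≤ 1 := by
    rw [← measure_biUnion_finset hdisj fun j _ => measurable_zpow R j hC]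
    exact prob_le_one
  simp only [measure_zpow_preimage hinv, Finset.sum_const, Finset.card_range, nsmul_eq_mul] at hsum
  rw [ENNReal.le_inv_iff_mul_le, mul_comm]
  exact hsum

/-- A measurable set contains a subset of small measure, disjoint from its image, meeting
almost every orbit that starts in the set. -/
theorem exists_small_sweeping_subset [T2Space M] [SecondCountableTopology M]
    [IsProbabilityMeasure μ] (hinv : MeasurePreserving R μ μ) {A : Set M}
    (hA : MeasurableSet A) {δ : ℝ≥0∞} (hδ : δ ≠ 0) :
    ∃ C ⊆ A, MeasurableSet C ∧ μ C < δ ∧ (∀ x ∈ C, R x ∉ C) ∧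
      A \ Function.periodicPts R ⊆ orbitSaturation R C := by
  obtain ⟨n, hn⟩ := ENNReal.exists_inv_nat_lt hδ
  obtain ⟨C, hCA, hC, hd, hsat⟩ := exists_sweeping_subset R hA (n + 1)
  refine ⟨C, hCA, hC, ?_, fun x hx => ?_, hsat⟩
  · refine (measure_le_inv_of_disjoint_iterates hinv hC (N := n) fun j hj => hd j ?_).trans_lt hn
    simp only [Finset.mem_Icc] at hj ⊢
    omega
  · simpa using hd 1 (by simp) x hx

/-- Almost every orbit that meets a measurable set meets it infinitely often in the future and in
the past. -/
theorem ae_forall_exists_ge_of_mem_orbitSaturation [IsFiniteMeasure μ]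
    (hinv : MeasurePreserving R μ μ) {C : Set M} (hC : MeasurableSet C) :
    ∀ᵐ x ∂μ, x ∈ orbitSaturation R C →
      ∀ N : ℕ, (∃ n ≥ N, (R ^ (n : ℤ)) x ∈ C) ∧ ∃ n ≥ N, (R ^ (-(n : ℤ))) x ∈ C := by
  have hsymm : MeasurePreserving R.symm μ μ :=
    MeasurePreserving.symm R.toMeasurableEquiv hinv
  have h1 := hinv.conservative.ae_mem_imp_frequently_image_mem hC.nullMeasurableSet
  have h2 := hsymm.conservative.ae_mem_imp_frequently_image_mem hC.nullMeasurableSet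
  have h : ∀ᵐ x ∂μ, ∀ k : ℤ, ((R ^ k) x ∈ C → ∃ᶠ n in atTop, R^[n] ((R ^ k) x) ∈ C) ∧
      ((R ^ k) x ∈ C → ∃ᶠ n in atTop, R.symm^[n] ((R ^ k) x) ∈ C) :=
    ae_all_iff.2 fun k => (hinv.zpow k).quasiMeasurePreserving.ae (h1.and h2)
  filter_upwards [h] with x hx hsat N
  obtain ⟨k, hk⟩ := (mem_orbitSaturation_iff _ _ _).1 hsat
  obtain ⟨hf, hb⟩ := hx k
  -- Recurrence is counted from `R^k x`; the margin `|k|` absorbs the shift back to `x`.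
  obtain ⟨n, hn, hnC⟩ := frequently_atTop.1 (hf hk) (N + k.natAbs)
  obtain ⟨m, hm, hmC⟩ := frequently_atTop.1 (hb hk) (N + k.natAbs)
  rw [← R.zpow_natCast_apply, ← R.zpow_add_apply] at hnC
  rw [← R.zpow_neg_natCast_apply, ← R.zpow_add_apply] at hmC
  refine ⟨⟨(n + k).toNat, by omega, ?_⟩, ⟨(m - k).toNat, by omega, ?_⟩⟩
  · rwa [Int.toNat_of_nonneg (by omega)]
  · rw [Int.toNat_of_nonneg (by omega)]
    convert hmC using 3
    ring

/-- Removing a small part of a set changes the measure of its saturation only a little. -/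
theorem exists_forall_measure_orbitSaturation_diff_lt [IsFiniteMeasure μ]
    (hinv : MeasurePreserving R μ μ) {A : Set M} (hA : MeasurableSet A) {ε : ℝ≥0∞} (hε : ε ≠ 0) :
    ∃ δ : ℝ≥0∞, δ ≠ 0 ∧ ∀ B : Set M, μ (A \ B) < δ →
      μ (orbitSaturation R A \ orbitSaturation R B) < ε := by
  -- Orbits that meet `A`, but not during the times `[-n, n]`: their measure tends to 0. The other
  -- orbits lose at most the `2n + 1` preimages of `A \ B`.
  let S : ℕ → Set M := fun n =>
    orbitSaturation R A \ ⋃ k ∈ Finset.Icc (-(n : ℤ)) n, (R ^ k) ⁻¹' A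
  have hanti : Antitone S := fun m n hmn =>
    sdiff_subset_sdiff_right (biUnion_subset_biUnion_left fun k hk => by
      simp only [Finset.mem_coe, Finset.mem_Icc] at hk ⊢; omega)
  have hSm : ∀ n, NullMeasurableSet (S n) μ := fun n =>
    (hA.orbitSaturation.diff (.biUnion (Finset.countable_toSet _)
      fun k _ => measurable_zpow R k hA)).nullMeasurableSet
  have hlim := tendsto_measure_iInter_atTop hSm hanti ⟨0, measure_ne_top μ _⟩
  have hempty : ⋂ n, S n = ∅ := by
    refine eq_empty_of_forall_notMem fun x hx => ?_
    obtain ⟨k, hk⟩ := (mem_orbitSaturation_iff _ _ _).1 (mem_iInter.1 hx 0).1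
    refine (mem_iInter.1 hx k.natAbs).2 (mem_iUnion₂.2 ⟨k, ?_, hk⟩)
    simp only [Finset.mem_Icc]; omega
  rw [hempty, measure_empty] at hlim
  have hε2 : ε / 2 ≠ 0 := (ENNReal.half_pos hε).ne'
  obtain ⟨n, hn⟩ := (hlim.eventually_lt_const (pos_iff_ne_zero.2 hε2)).exists
  refine ⟨ε / 2 / (2 * n + 1), ENNReal.div_ne_zero.2 ⟨hε2, by finiteness⟩, fun B hB => ?_⟩
  have hsub : orbitSaturation R A \ orbitSaturation R B ⊆
      S n ∪ ⋃ k ∈ Finset.Icc (-(n : ℤ)) n, (R ^ k) ⁻¹' (A \ B) := by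
    rintro x ⟨hx, hxB⟩
    by_cases h : ∃ k ∈ Finset.Icc (-(n : ℤ)) n, (R ^ k) x ∈ A
    · obtain ⟨k, hk, hkA⟩ := h
      exact Or.inr (mem_iUnion₂.2 ⟨k, hk, hkA,
        fun h => hxB ((mem_orbitSaturation_iff _ _ _).2 ⟨k, h⟩)⟩)
    · refine Or.inl ⟨hx, fun h' => h ?_⟩
      simpa using h'
  have hle : μ (⋃ k ∈ Finset.Icc (-(n : ℤ)) n, (R ^ k) ⁻¹' (A \ B)) ≤ ε / 2 := by
    refine (measure_biUnion_zpow_preimage_le hinv n _).trans ?_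
    exact (ENNReal.le_div_iff_mul_le (Or.inl (by positivity)) (Or.inl (by finiteness))).1 hB.le
  calc μ (orbitSaturation R A \ orbitSaturation R B)
      ≤ μ (S n) + μ (⋃ k ∈ Finset.Icc (-(n : ℤ)) n, (R ^ k) ⁻¹' (A \ B)) :=
        (measure_mono hsub).trans (measure_union_le _ _)
    _ < ε / 2 + ε / 2 := ENNReal.add_lt_add_of_lt_of_le (measure_ne_top _ _) hn hle
    _ = ε := ENNReal.add_halves ε

end Dynamics

/-! ### Closed subsets whose visits to themselves are relatively open. -/

section Coherence

variable {M : Type*} [TopologicalSpace M]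

/-- The points whose orbit reaches `D`, in the future or in the past, before meeting `C`: cutting
orbits at their visits to `C`, this is the union of the resulting blocks that meet `D`. -/
def blockSaturation (R : M ≃ₜ M) (C D : Set M) : Set M :=
  {x | ∃ j : ℤ, (R ^ j) x ∈ D ∧ ∀ i ∈ uIcc 0 j, (R ^ i) x ∉ C}

/-- The two `C`-free stretches, from `0` to `k` and from `k` to `k + j`, together cover the times
from `0` to `k + j`. Hence deleting blocks treats alike two points not separated by `C`. -/
theorem mem_blockSaturation_of_zpow_mem {R : M ≃ₜ M} {C D : Set M} {x : M} {k : ℤ}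
    (hk : ∀ i ∈ uIcc 0 k, (R ^ i) x ∉ C) (h : (R ^ k) x ∈ blockSaturation R C D) :
    x ∈ blockSaturation R C D := by
  obtain ⟨j, hj, hjC⟩ := h
  rw [← R.zpow_add_apply] at hj
  refine ⟨j + k, hj, fun i hi => ?_⟩
  by_cases hik : i ∈ uIcc 0 k
  · exact hk i hik
  · have := hjC (i - k) (by rw [mem_uIcc] at hi hik ⊢; omega)
    rwa [← R.zpow_add_apply, sub_add_cancel] at this

variable [MeasurableSpace M] [BorelSpace M] {R : M ≃ₜ M} {μ : Measure M}

theorem MeasurableSet.blockSaturation {C D : Set M} (hC : MeasurableSet C)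
    (hD : MeasurableSet D) : MeasurableSet (blockSaturation R C D) := by
  have : _root_.blockSaturation R C D =
      ⋃ j : ℤ, ((R ^ j) ⁻¹' D ∩ ⋂ i ∈ uIcc 0 j, ((R ^ i) ⁻¹' C)ᶜ) := by
    ext x; simp [_root_.blockSaturation]
  rw [this]
  exact .iUnion fun j => (measurable_zpow R j hD).inter
    (.biInter (to_countable _) fun i _ => (measurable_zpow R i hC).compl)

/-- If almost every orbit meets `C` in the future and in the past, the union of the blocks that
meet a set of small measure has small measure. -/
theorem exists_forall_measure_blockSaturation_lt [IsFiniteMeasure μ]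
    (hinv : MeasurePreserving R μ μ) {C : Set M} (hC : MeasurableSet C)
    (hvisit : ∀ᵐ x ∂μ, (∃ n : ℕ, (R ^ (n : ℤ)) x ∈ C) ∧ ∃ n : ℕ, (R ^ (-(n : ℤ))) x ∈ C)
    {ε : ℝ≥0∞} (hε : ε ≠ 0) :
    ∃ δ : ℝ≥0∞, δ ≠ 0 ∧ ∀ D : Set M, μ D < δ → μ (blockSaturation R C D) < ε := by
  -- Off `S n`, the orbit meets `C` within `n` steps on both sides, so its block can reach `D` only
  -- at times in `[-n, n]`.
  let S : ℕ → Set M := fun n =>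
    (⋂ i ∈ Finset.Icc (0 : ℤ) n, ((R ^ i) ⁻¹' C)ᶜ) ∪ ⋂ i ∈ Finset.Icc (-(n : ℤ)) 0, ((R ^ i) ⁻¹' C)ᶜ
  have hanti : Antitone S := fun m n hmn =>
    union_subset_union
      (biInter_subset_biInter_left fun k hk => by
        simp only [Finset.mem_coe, Finset.mem_Icc] at hk ⊢; omega)
      (biInter_subset_biInter_left fun k hk => by
        simp only [Finset.mem_coe, Finset.mem_Icc] at hk ⊢; omega)
  have hSm : ∀ n, NullMeasurableSet (S n) μ := fun n =>
    ((MeasurableSet.biInter (Finset.countable_toSet _)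
      fun k _ => (measurable_zpow R k hC).compl).union
      (MeasurableSet.biInter (Finset.countable_toSet _)
        fun k _ => (measurable_zpow R k hC).compl)).nullMeasurableSet
  have hlim := tendsto_measure_iInter_atTop hSm hanti ⟨0, measure_ne_top μ _⟩
  have hnull : μ (⋂ n, S n) = 0 := by
    refine measure_mono_null (fun x hx => ?_) (ae_iff.1 hvisit)
    rintro ⟨⟨n, hn⟩, ⟨m, hm⟩⟩
    rcases mem_iInter.1 hx (max n m) with h | h
    · exact mem_iInter₂.1 h n (by simp) hn
    · exact mem_iInter₂.1 h (-(m : ℤ)) (by simp) hm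
  rw [hnull] at hlim
  have hε2 : ε / 2 ≠ 0 := (ENNReal.half_pos hε).ne'
  obtain ⟨n, hn⟩ := (hlim.eventually_lt_const (pos_iff_ne_zero.2 hε2)).exists
  refine ⟨ε / 2 / (2 * n + 1), ENNReal.div_ne_zero.2 ⟨hε2, by finiteness⟩, fun D hD => ?_⟩
  have hsub : blockSaturation R C D ⊆ S n ∪ ⋃ k ∈ Finset.Icc (-(n : ℤ)) n, (R ^ k) ⁻¹' D := by
    rintro x ⟨j, hj, hjC⟩
    by_cases h : j ∈ Finset.Icc (-(n : ℤ)) n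
    · exact Or.inr (mem_iUnion₂.2 ⟨j, h, hj⟩)
    · rw [Finset.mem_Icc] at h
      rcases lt_or_ge 0 j with h0 | h0
      · refine Or.inl (Or.inl (mem_iInter₂.2 fun i hi => hjC i ?_))
        rw [Finset.mem_Icc] at hi
        rw [mem_uIcc]; omega
      · refine Or.inl (Or.inr (mem_iInter₂.2 fun i hi => hjC i ?_))
        rw [Finset.mem_Icc] at hi
        rw [mem_uIcc]; omega
  have hle : μ (⋃ k ∈ Finset.Icc (-(n : ℤ)) n, (R ^ k) ⁻¹' D) ≤ ε / 2 := by
    refine (measure_biUnion_zpow_preimage_le hinv n _).trans ?_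
    exact (ENNReal.le_div_iff_mul_le (Or.inl (by positivity)) (Or.inl (by finiteness))).1 hD.le
  calc μ (blockSaturation R C D)
      ≤ μ (S n) + μ (⋃ k ∈ Finset.Icc (-(n : ℤ)) n, (R ^ k) ⁻¹' D) :=
        (measure_mono hsub).trans (measure_union_le _ _)
    _ < ε / 2 + ε / 2 := ENNReal.add_lt_add_of_lt_of_le (measure_ne_top _ _) hn hle
    _ = ε := ENNReal.add_halves ε

/-- The inductive step for `exists_isClosed_coherent_subset`: `S` loses only few points, the loss
is invariant under jumps of length at most `m` inside `S`, and on what remains the visits to `S`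
are described by closed sets. -/
theorem exists_subset_closed_approx [μ.WeaklyRegular] [IsFiniteMeasure μ]
    (hinv : MeasurePreserving R μ μ) {C S : Set M} (hC : MeasurableSet C) (hS : MeasurableSet S)
    (hvisit : ∀ᵐ x ∂μ, (∃ n : ℕ, (R ^ (n : ℤ)) x ∈ C) ∧ ∃ n : ℕ, (R ^ (-(n : ℤ))) x ∈ C)
    {m : ℕ} (hgap : ∀ x ∈ C, ∀ j : ℕ, j ≤ m → (R ^ (j : ℤ)) x ∉ S) {ε : ℝ≥0∞} (hε : ε ≠ 0) :
    ∃ S' ⊆ S, MeasurableSet S' ∧ μ (S \ S') < ε ∧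
      (∀ x ∈ S', ∀ k : ℤ, k.natAbs ≤ m → (R ^ k) x ∈ S → (R ^ k) x ∈ S') ∧
      ∀ k : ℤ, ∃ F G : Set M, IsClosed F ∧ IsClosed G ∧ F ⊆ (R ^ k) ⁻¹' S ∧
        Disjoint G ((R ^ k) ⁻¹' S) ∧ S' ⊆ F ∪ G := by
  obtain ⟨δ, hδ, hblock⟩ := exists_forall_measure_blockSaturation_lt hinv hC hvisit hε
  obtain ⟨δ', hδ'0, hδ'⟩ := ENNReal.exists_pos_sum_of_countable' hδ (ℤ × Bool)
  have hQ : ∀ k : ℤ, MeasurableSet ((R ^ k) ⁻¹' S) := fun k => measurable_zpow R k hS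
  have hF : ∀ k : ℤ, ∃ F ⊆ (R ^ k) ⁻¹' S, IsClosed F ∧ μ ((R ^ k) ⁻¹' S \ F) < δ' (k, true) :=
    fun k => (hQ k).exists_isClosed_sdiff_lt (measure_ne_top _ _) (hδ'0 _).ne'
  have hG : ∀ k : ℤ, ∃ G ⊆ ((R ^ k) ⁻¹' S)ᶜ, IsClosed G ∧
      μ (((R ^ k) ⁻¹' S)ᶜ \ G) < δ' (k, false) :=
    fun k => (hQ k).compl.exists_isClosed_sdiff_lt (measure_ne_top _ _) (hδ'0 _).ne'
  choose F hFS hFc hFμ using hF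
  choose G hGS hGc hGμ using hG
  -- Regularity errors: `true` for the visits missed by `F k`, `false` for the non-visits missed by
  -- `G k`.
  let E : ℤ × Bool → Set M := fun p =>
    if p.2 then (R ^ p.1) ⁻¹' S \ F p.1 else ((R ^ p.1) ⁻¹' S)ᶜ \ G p.1
  have hEm : ∀ p, MeasurableSet (E p) := by
    rintro ⟨k, _ | _⟩
    · exact (hQ k).compl.diff (hGc k).measurableSet
    · exact (hQ k).diff (hFc k).measurableSet
  have hEμ : ∀ p, μ (E p) ≤ δ' p := by
    rintro ⟨k, _ | _⟩
    · exact (hGμ k).le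
    · exact (hFμ k).le
  let D : Set M := ⋃ p, E p
  have hD : μ D < δ := (measure_iUnion_le E).trans_lt ((ENNReal.tsum_le_tsum hEμ).trans_lt hδ')
  have hSC : ∀ x ∈ S, x ∉ C := fun x hx hxC => hgap x hxC 0 (Nat.zero_le _) (by simpa using hx)
  -- no visit to `C` separates two points of `S` at most `m` steps apart
  have hnoC : ∀ x ∈ S, ∀ k : ℤ, k.natAbs ≤ m → (R ^ k) x ∈ S → ∀ i ∈ uIcc 0 k, (R ^ i) x ∉ C := by
    intro x hx k hk hkS i hi hiC
    rw [mem_uIcc] at hi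
    -- The later of the two points, `R^k x` or `x`, follows the marker `R^i x` by at most `m` steps,
    -- against `hgap`.
    rcases le_total 0 k with h0 | h0
    · refine hgap _ hiC (k - i).toNat (by omega) ?_
      rwa [← R.zpow_add_apply, Int.toNat_of_nonneg (by omega), sub_add_cancel]
    · refine hgap _ hiC (-i).toNat (by omega) ?_
      rwa [← R.zpow_add_apply, Int.toNat_of_nonneg (by omega), neg_add_cancel, zpow_zero]
  refine ⟨S \ blockSaturation R C D, sdiff_subset,
    hS.diff (hC.blockSaturation (.iUnion hEm)), ?_, ?_, fun k => ?_⟩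
  · rw [sdiff_sdiff_right_self]
    exact (measure_mono inter_subset_right).trans_lt (hblock D hD)
  · intro x hx k hk hkS
    exact ⟨hkS, fun h => hx.2 (mem_blockSaturation_of_zpow_mem (hnoC x hx.1 k hk hkS) h)⟩
  · refine ⟨F k, G k, hFc k, hGc k, hFS k, disjoint_left.2 fun x hx => hGS k hx, ?_⟩
    intro x hx
    -- Time `j = 0`: a point outside `C` belongs to its own block.
    have hxD : x ∉ D := fun h => hx.2 ⟨0, by simpa using h, by simpa using hSC x hx.1⟩
    by_contra hcon
    rw [mem_union, not_or] at hcon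
    by_cases hxS : (R ^ k) x ∈ S
    · exact hxD (mem_iUnion.2 ⟨(k, true), hxS, hcon.1⟩)
    · exact hxD (mem_iUnion.2 ⟨(k, false), hxS, hcon.2⟩)

/-- A measurable set with long gaps along almost every orbit contains, up to small measure, a
closed set `K` whose intersections with its iterates are relatively open in `K`. -/
theorem exists_isClosed_coherent_subset [μ.WeaklyRegular] [IsFiniteMeasure μ]
    (hinv : MeasurePreserving R μ μ) {B : Set M} (hB : MeasurableSet B) {C : ℕ → Set M}
    (hC : ∀ m, MeasurableSet (C m))
    (hvisit : ∀ m, ∀ᵐ x ∂μ,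
      (∃ n : ℕ, (R ^ (n : ℤ)) x ∈ C m) ∧ ∃ n : ℕ, (R ^ (-(n : ℤ))) x ∈ C m)
    (hgap : ∀ m, ∀ x ∈ C m, ∀ j : ℕ, j ≤ m → (R ^ (j : ℤ)) x ∉ B) {ε : ℝ≥0∞} (hε : ε ≠ 0) :
    ∃ K ⊆ B, IsClosed K ∧ μ (B \ K) < ε ∧
      ∀ k : ℤ, ∃ G : Set M, IsClosed G ∧ ∀ x ∈ K, x ∈ G ↔ (R ^ k) x ∉ K := by
  obtain ⟨δ, hδ0, hδ⟩ := ENNReal.exists_pos_sum_of_countable' hε ℕ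
  have step : ∀ (m : ℕ) (S : {S : Set M // MeasurableSet S ∧ S ⊆ B}),
      ∃ S' : {S : Set M // MeasurableSet S ∧ S ⊆ B}, S'.1 ⊆ S.1 ∧ μ (S.1 \ S'.1) < δ m ∧
      (∀ x ∈ S'.1, ∀ k : ℤ, k.natAbs ≤ m → (R ^ k) x ∈ S.1 → (R ^ k) x ∈ S'.1) ∧
      ∀ k : ℤ, ∃ F G : Set M, IsClosed F ∧ IsClosed G ∧ F ⊆ (R ^ k) ⁻¹' S.1 ∧
        Disjoint G ((R ^ k) ⁻¹' S.1) ∧ S'.1 ⊆ F ∪ G := by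
    rintro m ⟨S, hS, hSB⟩
    obtain ⟨S', hS'S, hS', h⟩ := exists_subset_closed_approx hinv (hC m) hS (hvisit m)
      (fun x hx j hj hjS => hgap m x hx j hj (hSB hjS)) (hδ0 m).ne'
    exact ⟨⟨S', hS', hS'S.trans hSB⟩, hS'S, h⟩
  choose next hsub hμ hjump hclosed using step
  let T : ℕ → {S : Set M // MeasurableSet S ∧ S ⊆ B} :=
    fun n => Nat.rec ⟨B, hB, Subset.rfl⟩ (fun m S => next m S) n
  have hT : ∀ m, T (m + 1) = next m (T m) := fun m => rfl
  have hanti : Antitone fun m => (T m).1 := antitone_nat_of_succ_le fun m => hsub m (T m)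
  let K : Set M := ⋂ m, (T m).1
  have hKT : ∀ m, K ⊆ (T m).1 := fun m => iInter_subset _ m
  -- From stage `|k|` on, jumps by `k` are short enough for every deletion to respect them.
  have hstable : ∀ x ∈ K, ∀ k : ℤ, (R ^ k) x ∈ (T k.natAbs).1 → (R ^ k) x ∈ K := by
    intro x hx k hk
    refine mem_iInter.2 fun n => ?_
    rcases le_total n k.natAbs with h | h
    · exact hanti h hk
    · induction n, h using Nat.le_induction with
      | base => exact hk
      | succ n hn ih => exact hjump n (T n) x (hKT (n + 1) hx) k hn ih
  refine ⟨K, hKT 0, ?_, ?_, fun k => ?_⟩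
  -- Time `k = 0` at stage `m` interposes a closed set between `K` and `T m`.
  · refine isClosed_of_closure_subset fun x hx => mem_iInter.2 fun m => ?_
    obtain ⟨F, G, hF, hG, hFS, hGS, hcov⟩ := hclosed m (T m) 0
    have hKF : K ⊆ F := by
      intro y hy
      rcases hcov (hKT (m + 1) hy) with h | h
      · exact h
      · exact (disjoint_left.1 hGS h (by simpa using hKT m hy)).elim
    simpa using hFS (closure_minimal hKF hF hx)
  · have hdiff : B \ K ⊆ ⋃ m, (T m).1 \ (T (m + 1)).1 := by
      rintro x ⟨hxB, hxK⟩
      classical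
      have hex : ∃ n, x ∉ (T n).1 := by
        by_contra! h
        exact hxK (mem_iInter.2 h)
      have h0 : Nat.find hex ≠ 0 := fun h => by
        have := Nat.find_spec hex
        rw [h] at this
        exact this hxB
      obtain ⟨n, hn⟩ := Nat.exists_eq_succ_of_ne_zero h0
      refine mem_iUnion.2 ⟨n, not_not.1 (Nat.find_min hex (m := n) (by omega)), ?_⟩
      have := Nat.find_spec hex
      rwa [hn] at this
    calc μ (B \ K) ≤ ∑' m, μ ((T m).1 \ (T (m + 1)).1) :=
          (measure_mono hdiff).trans (measure_iUnion_le _)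
      _ ≤ ∑' m, δ m := ENNReal.tsum_le_tsum fun m => (hμ m (T m)).le
      _ < ε := hδ
  -- Stage `|k|` is where the visits at time `k` become final.
  · obtain ⟨F, G, hF, hG, hFS, hGS, hcov⟩ := hclosed k.natAbs (T k.natAbs) k
    refine ⟨G, hG, fun x hx => ⟨fun h hk => disjoint_left.1 hGS h (hKT _ hk), fun h => ?_⟩⟩
    rcases hcov (hKT (k.natAbs + 1) hx) with h' | h'
    · exact (h (hstable x hx k (hFS h'))).elim
    · exact h'

end Coherence

/-! ### Disjoint small rectangles filling a manifold up to small measure. -/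

section Tame

open Metric

theorem Set.Finite.isClosed_sUnion {X : Type*} [TopologicalSpace X] {E : Set (Set X)}
    (hE : E.Finite) (h : ∀ s ∈ E, IsClosed s) : IsClosed (⋃₀ E) := by
  rw [sUnion_eq_biUnion]
  exact hE.isClosed_biUnion h

theorem isRectangle_closedBall {d : ℕ} (x : EuclideanSpace ℝ (Fin d)) {r : ℝ} (hr : 0 < r) :
    IsRectangle d (closedBall x r) := by
  let h := (Homeomorph.smulOfNeZero r hr.ne').trans (Homeomorph.addLeft x)
  have himage : h '' closedBall (0 : EuclideanSpace ℝ (Fin d)) 1 = closedBall x r := by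
    rw [← affinity_unitClosedBall hr.le x, ← image_vadd, ← image_smul, image_image]
    rfl
  exact ⟨((h.image _).trans (Homeomorph.setCongr himage)).symm⟩

theorem IsRectangle.of_homeomorph {d : ℕ} {X Y : Type*} [TopologicalSpace X] [TopologicalSpace Y]
    {s : Set X} {t : Set Y} (hs : IsRectangle d s) (e : s ≃ₜ t) : IsRectangle d t :=
  hs.map e.symm.trans

variable {d : ℕ} {M : Type*} [MetricSpace M]

/-- A compact set contained, at each scale, in the interior of a finite disjoint union of small
rectangles is tamely embedded. -/
theorem isTamelyEmbedded_of_forall_rectangles {K : Set M} (hK : IsCompact K)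
    (h : ∀ η > 0, ∃ E : Set (Set M), E.Finite ∧
      (∀ X ∈ E, IsRectangle d X ∧ IsCompact X ∧ ∀ x ∈ X, ∀ y ∈ X, dist x y < η) ∧
      E.PairwiseDisjoint id ∧ K ⊆ interior (⋃₀ E)) : IsTamelyEmbedded d K := by
  intro U hU hKU
  obtain ⟨η, hη, hηU⟩ := hK.exists_thickening_subset_open hU hKU
  obtain ⟨E, hEf, hE, hEd, hKE⟩ := h η hη
  -- Rectangles that meet `K` stay within `η` of it; the discarded ones form a closed set missing
  -- `K`.
  refine ⟨{X ∈ E | (X ∩ K).Nonempty}, hEf.subset (sep_subset _ _), fun X hX => (hE X hX.1).1,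
    hEd.subset (sep_subset _ _), ?_, ?_⟩
  · have hc : IsClosed (⋃₀ {X ∈ E | ¬ (X ∩ K).Nonempty}) :=
      (hEf.subset (sep_subset _ _)).isClosed_sUnion fun X hX => (hE X hX.1).2.1.isClosed
    intro x hx
    refine mem_interior.2 ⟨interior (⋃₀ E) \ ⋃₀ {X ∈ E | ¬ (X ∩ K).Nonempty}, ?_,
      isOpen_interior.sdiff hc, hKE hx, ?_⟩
    · rintro y ⟨hy, hyn⟩
      obtain ⟨X, hX, hyX⟩ := interior_subset hy
      exact ⟨X, ⟨hX, by_contra fun hXK => hyn ⟨X, ⟨hX, hXK⟩, hyX⟩⟩, hyX⟩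
    · rintro ⟨X, ⟨-, hX⟩, hxX⟩
      exact hX ⟨x, hxX, hx⟩
  · rintro y ⟨X, ⟨hX, z, hzX, hzK⟩, hyX⟩
    exact hηU (mem_thickening_iff.2 ⟨z, hzK, (hE X hX).2.2 y hyX z hzX⟩)

/-- A set covered, at each scale, by finitely many pairwise disjoint small compact sets is totally
disconnected. -/
theorem isTotallyDisconnected_of_forall_cover {K : Set M}
    (h : ∀ η > 0, ∃ E : Set (Set M), E.Finite ∧
      (∀ X ∈ E, IsCompact X ∧ ∀ x ∈ X, ∀ y ∈ X, dist x y < η) ∧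
      E.PairwiseDisjoint id ∧ K ⊆ ⋃₀ E) : IsTotallyDisconnected K := by
  intro S hSK hS x hx y hy
  by_contra hne
  obtain ⟨E, hEf, hE, hEd, hKE⟩ := h _ (dist_pos.2 hne)
  obtain ⟨X, hX, hxX⟩ := hKE (hSK hx)
  have hc : IsClosed (⋃₀ (E \ {X})) :=
    (hEf.subset sdiff_subset).isClosed_sUnion fun Y hY => (hE Y hY.1).1.isClosed
  have hdisj : Disjoint X (⋃₀ (E \ {X})) :=
    disjoint_sUnion_right.2 fun Y hY => hEd hX hY.1 (Ne.symm hY.2)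
  have hcov : S ⊆ X ∪ ⋃₀ (E \ {X}) := by
    intro z hz
    obtain ⟨Y, hY, hzY⟩ := hKE (hSK hz)
    by_cases hYX : Y = X
    · exact Or.inl (hYX ▸ hzY)
    · exact Or.inr ⟨Y, ⟨hY, hYX⟩, hzY⟩
  rcases (isPreconnected_closed_iff.1 hS X _ (hE X hX).1.isClosed hc hcov ⟨x, hx, hxX⟩).mt
    (fun ⟨z, _, hz⟩ => disjoint_left.1 hdisj hz.1 hz.2) with hempty
  rcases hcov hy with hyX | hyX
  · exact lt_irrefl _ ((hE X hX).2 x hxX y hyX)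
  · exact hempty ⟨y, hy, hyX⟩

variable [MeasurableSpace M] [BorelSpace M]

/-- An open set inside the domain of a chart is, up to small measure, a finite disjoint union of
small rectangles with negligible boundary. -/
theorem exists_finite_rectangles_in_chart (μ : Measure M) [IsFiniteMeasure μ]
    (c : OpenPartialHomeomorph M (EuclideanSpace ℝ (Fin d))) {V : Set M} (hV : IsOpen V)
    (hVc : V ⊆ c.source) {η : ℝ} (hη : 0 < η) {δ : ℝ≥0∞} (hδ : δ ≠ 0) :
    ∃ E : Set (Set M), E.Finite ∧ (∀ X ∈ E, IsRectangle d X ∧ IsCompact X ∧ X ⊆ V ∧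
      (∀ x ∈ X, ∀ y ∈ X, dist x y < η) ∧ μ (X \ interior X) = 0) ∧
      E.PairwiseDisjoint id ∧ μ (V \ ⋃₀ E) < δ := by
  classical
  have hcm : AEMeasurable c (μ.restrict c.source) :=
    c.continuousOn.aemeasurable c.open_source.measurableSet
  let ν := (μ.restrict c.source).map c
  let s : Set (EuclideanSpace ℝ (Fin d)) := c.target ∩ c.symm ⁻¹' V
  have hs : IsOpen s := c.isOpen_inter_preimage_symm hV
  have hνμ : ∀ {S : Set (EuclideanSpace ℝ (Fin d))}, MeasurableSet S → ν S = 0 →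
      μ (c ⁻¹' S ∩ c.source) = 0 := by
    intro S hS h
    rwa [Measure.map_apply_of_aemeasurable hcm hS,
      Measure.restrict_apply' c.open_source.measurableSet] at h
  -- Admissible radii for the Besicovitch covering theorem; the null sphere will make the boundary
  -- of the rectangle negligible.
  let f : EuclideanSpace ℝ (Fin d) → Set ℝ := fun x => {r | closedBall x r ⊆ s ∧
    (∀ y ∈ closedBall x r, ∀ z ∈ closedBall x r, dist (c.symm y) (c.symm z) < η) ∧
    ν (sphere x r) = 0}
  have hf : ∀ x ∈ s, ∀ ε > 0, (f x ∩ Ioo 0 ε).Nonempty := by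
    intro x hx ε hε
    have hopen : IsOpen (c.target ∩ c.symm ⁻¹' (V ∩ ball (c.symm x) (η / 2))) :=
      c.isOpen_inter_preimage_symm (hV.inter isOpen_ball)
    obtain ⟨ρ, hρ, hρs⟩ := Metric.isOpen_iff.1 hopen x
      ⟨hx.1, hx.2, mem_ball_self (half_pos hη)⟩
    -- A finite measure charges only countably many concentric spheres.
    have hcount : {r : ℝ | 0 < ν {y | dist y x = r}}.Countable :=
      Measure.countable_meas_level_set_pos (g := fun y => dist y x) (by fun_prop)
    obtain ⟨r, hr, hr0, hrlt⟩ := (hcount.dense_compl ℝ).exists_between (lt_min hε hρ)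
    have hball : closedBall x r ⊆ ball x ρ := closedBall_subset_ball (hrlt.trans_le (min_le_right _ _))
    refine ⟨r, ⟨fun y hy => ⟨(hρs (hball hy)).1, (hρs (hball hy)).2.1⟩, fun y hy z hz => ?_, ?_⟩,
      hr0, hrlt.trans_le (min_le_left _ _)⟩
    · have h1 := (hρs (hball hy)).2.2
      have h2 := (hρs (hball hz)).2.2
      rw [mem_ball] at h1 h2
      linarith [dist_triangle_right (c.symm y) (c.symm z) (c.symm x)]
    · have : sphere x r = {y | dist y x = r} := rfl
      rw [this]
      simpa using hr
  obtain ⟨t, r, htc, hts, hr, htμ, hdisj⟩ :=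
    Besicovitch.exists_disjoint_closedBall_covering_ae ν f s hf (fun _ => 1) fun _ _ => one_pos
  let X : t → Set M := fun x => c.symm '' closedBall x.1 (r x)
  have hrs : ∀ x : t, closedBall x.1 (r x) ⊆ s := fun x => (hr x x.2).1.1
  have hr0 : ∀ x : t, 0 < r x := fun x => (hr x x.2).2.1
  have hrt : ∀ x : t, closedBall x.1 (r x) ⊆ c.target := fun x => (hrs x).trans inter_subset_left
  have hXc : ∀ x, IsCompact (X x) := fun x =>
    (isCompact_closedBall _ _).image_of_continuousOn (c.symm.continuousOn.mono (hrt x))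
  have hXdisj : ∀ x y, x ≠ y → Disjoint (X x) (X y) := by
    intro x y hxy
    rw [disjoint_left]
    rintro _ ⟨a, ha, rfl⟩ ⟨b, hb, hab⟩
    have : a = b := c.symm.injOn (hrt x ha) (hrt y hb) hab.symm
    subst this
    exact disjoint_left.1 (hdisj x.2 y.2 fun h => hxy (Subtype.ext h)) ha hb
  have : Countable t := htc.to_subtype
  -- Continuity from above along finite subfamilies replaces the countable covering by a finite one.
  let W : Finset t → Set M := fun u => V \ ⋃ x ∈ u, X x
  have hW : Antitone W := fun u v huv =>
    sdiff_subset_sdiff_right (biUnion_subset_biUnion_left huv)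
  have hWm : ∀ u, NullMeasurableSet (W u) μ := fun u =>
    (hV.measurableSet.diff (.biUnion (Finset.countable_toSet _)
      fun x _ => (hXc x).isClosed.measurableSet)).nullMeasurableSet
  have hlim := tendsto_measure_iInter_atTop hWm hW ⟨∅, measure_ne_top μ _⟩
  have hnull : μ (⋂ u, W u) = 0 := by
    have hmeas : MeasurableSet (s \ ⋃ x ∈ t, closedBall x (r x)) :=
      hs.measurableSet.diff (.biUnion htc fun x _ => isClosed_closedBall.measurableSet)
    refine measure_mono_null (fun y hy => ?_) (hνμ hmeas htμ)
    have hyV : y ∈ V := (mem_iInter.1 hy ∅).1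
    have hyc := hVc hyV
    refine ⟨⟨⟨c.map_source hyc, by simpa [c.left_inv hyc] using hyV⟩, fun h => ?_⟩, hyc⟩
    obtain ⟨x, hx, hyx⟩ := mem_iUnion₂.1 h
    refine (mem_iInter.1 hy {⟨x, hx⟩}).2 (mem_iUnion₂.2 ⟨⟨x, hx⟩, by simp, c y, hyx, ?_⟩)
    exact c.left_inv hyc
  rw [hnull] at hlim
  obtain ⟨u, hu⟩ := (hlim.eventually_lt_const (pos_iff_ne_zero.2 hδ)).exists
  refine ⟨X '' u, u.finite_toSet.image X, ?_, ?_, ?_⟩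
  · rintro _ ⟨x, -, rfl⟩
    refine ⟨?_, hXc x, ?_, ?_, ?_⟩
    · exact (isRectangle_closedBall x.1 (hr0 x)).of_homeomorph
        (c.symm.homeomorphOfImageSubsetSource (hrt x) rfl)
    · rintro _ ⟨y, hy, rfl⟩
      exact (hrs x hy).2
    · rintro _ ⟨y, hy, rfl⟩ _ ⟨z, hz, rfl⟩
      exact (hr x x.2).1.2.1 y hy z hz
    · refine measure_mono_null ?_ (hνμ isClosed_sphere.measurableSet (hr x x.2).1.2.2)
      rintro _ ⟨⟨y, hy, rfl⟩, hyi⟩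
      refine ⟨?_, c.map_target (hrt x hy)⟩
      rw [mem_preimage, c.right_inv (hrt x hy), mem_sphere]
      refine le_antisymm hy (le_of_not_gt fun hlt => hyi ?_)
      refine mem_interior.2 ⟨c.symm '' ball x.1 (r x), image_mono ball_subset_closedBall, ?_,
        mem_image_of_mem _ hlt⟩
      exact c.symm.isOpen_image_of_subset_source isOpen_ball
        (ball_subset_closedBall.trans (hrt x))
  · rintro _ ⟨x, -, rfl⟩ _ ⟨y, -, rfl⟩ hne
    exact hXdisj x y fun h => hne (h ▸ rfl)
  · simpa [W, sUnion_image] using hu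

/-- A compact manifold is, up to small measure, the interior of a finite disjoint union of small
rectangles. -/
theorem exists_finite_rectangles [CompactSpace M] [ChartedSpace (EuclideanSpace ℝ (Fin d)) M]
    (μ : Measure M) [IsFiniteMeasure μ] {η : ℝ} (hη : 0 < η) {δ : ℝ≥0∞} (hδ : δ ≠ 0) :
    ∃ E : Set (Set M), E.Finite ∧
      (∀ X ∈ E, IsRectangle d X ∧ IsCompact X ∧ ∀ x ∈ X, ∀ y ∈ X, dist x y < η) ∧
      E.PairwiseDisjoint id ∧ μ (interior (⋃₀ E))ᶜ < δ := by
  classical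
  have key : ∀ (t : Finset M) {δ : ℝ≥0∞}, δ ≠ 0 → ∃ E : Set (Set M), E.Finite ∧
      (∀ X ∈ E, IsRectangle d X ∧ IsCompact X ∧ (∀ x ∈ X, ∀ y ∈ X, dist x y < η) ∧
        μ (X \ interior X) = 0) ∧ E.PairwiseDisjoint id ∧
      μ ((⋃ x ∈ t, (chartAt (EuclideanSpace ℝ (Fin d)) x).source) \ ⋃₀ E) < δ := by
    intro t
    induction t using Finset.induction_on with
    | empty => exact fun hδ => ⟨∅, finite_empty, by simp, by simp, by simpa using pos_iff_ne_zero.2 hδ⟩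
    | insert a t _ ih =>
      intro δ hδ
      have hδ2 : δ / 2 ≠ 0 := (ENNReal.half_pos hδ).ne'
      obtain ⟨E, hEf, hE, hEd, hEμ⟩ := ih hδ2
      let c := chartAt (EuclideanSpace ℝ (Fin d)) a
      have hEc : IsClosed (⋃₀ E) := hEf.isClosed_sUnion fun X hX => (hE X hX).2.1.isClosed
      -- Only the part of the new chart domain off the old rectangles is filled, which keeps the
      -- family disjoint.
      obtain ⟨E', hE'f, hE', hE'd, hE'μ⟩ := exists_finite_rectangles_in_chart μ c
        (c.open_source.sdiff hEc) sdiff_subset hη hδ2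
      refine ⟨E ∪ E', hEf.union hE'f, ?_, ?_, ?_⟩
      · rintro X (hX | hX)
        · exact hE X hX
        · obtain ⟨h1, h2, -, h3⟩ := hE' X hX
          exact ⟨h1, h2, h3⟩
      · refine (pairwiseDisjoint_union).2 ⟨hEd, hE'd, fun X hX Y hY _ => ?_⟩
        exact disjoint_left.2 fun x hx hy => ((hE' Y hY).2.2.1 hy).2 (mem_sUnion.2 ⟨X, hX, hx⟩)
      · calc _ ≤ μ (((⋃ x ∈ t, (chartAt (EuclideanSpace ℝ (Fin d)) x).source) \ ⋃₀ E) ∪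
              ((c.source \ ⋃₀ E) \ ⋃₀ E')) := by
              refine measure_mono ?_
              rw [sUnion_union, Finset.set_biUnion_insert]
              rintro x ⟨hx | hx, hn⟩
              · exact Or.inr ⟨⟨hx, fun h => hn (Or.inl h)⟩, fun h => hn (Or.inr h)⟩
              · exact Or.inl ⟨hx, fun h => hn (Or.inl h)⟩
          _ ≤ _ := measure_union_le _ _
          _ < δ / 2 + δ / 2 := ENNReal.add_lt_add hEμ hE'μ
          _ = δ := ENNReal.add_halves δ
  obtain ⟨t, ht⟩ := CompactSpace.elim_nhds_subcover
    (fun x : M => (chartAt (EuclideanSpace ℝ (Fin d)) x).source)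
    fun x => chart_source_mem_nhds _ x
  obtain ⟨E, hEf, hE, hEd, hEμ⟩ := key t hδ
  refine ⟨E, hEf, fun X hX => ⟨(hE X hX).1, (hE X hX).2.1, (hE X hX).2.2.1⟩, hEd, ?_⟩
  rw [ht, top_eq_univ, ← compl_eq_univ_sdiff] at hEμ
  have hnull : μ (⋃ X ∈ E, X \ interior X) = 0 :=
    (measure_biUnion_null_iff hEf.countable).2 fun X hX => (hE X hX).2.2.2
  have hsub : (interior (⋃₀ E))ᶜ ⊆ (⋃₀ E)ᶜ ∪ ⋃ X ∈ E, X \ interior X := by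
    intro x hx
    by_cases h : x ∈ ⋃₀ E
    · obtain ⟨X, hX, hxX⟩ := h
      exact Or.inr (mem_iUnion₂.2 ⟨X, hX, hxX,
        fun h => hx (interior_mono (subset_sUnion_of_mem hX) h)⟩)
    · exact Or.inl h
  calc _ ≤ μ (⋃₀ E)ᶜ + μ (⋃ X ∈ E, X \ interior X) :=
        (measure_mono hsub).trans (measure_union_le _ _)
    _ < δ := by rwa [hnull, add_zero]

end Tame

/-! ### The small sets to delete, and the restriction to the support. -/

section Construction

variable {M : Type*} [TopologicalSpace M] [MeasurableSpace M] [BorelSpace M]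
  {R : M ≃ₜ M} {μ : Measure M}

/-- There are marker sets `C m`, visited infinitely often in the future and in the past by the
points outside a set `Z` of small measure, such that each visit to `C m` is followed by at least
`m` further iterates in `Z`. -/
theorem exists_markers [T2Space M] [SecondCountableTopology M] [IsProbabilityMeasure μ]
    (hinv : MeasurePreserving R μ μ) (haper : μ (Function.periodicPts R) = 0)
    {δ : ℝ≥0∞} (hδ : δ ≠ 0) :
    ∃ (C : ℕ → Set M) (Z : Set M), (∀ m, MeasurableSet (C m)) ∧ MeasurableSet Z ∧ μ Z < δ ∧
      (∀ m, ∀ x ∈ C m, ∀ j : ℕ, j ≤ m → (R ^ (j : ℤ)) x ∈ Z) ∧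
      (∀ m, ∀ᵐ x ∂μ, (∃ n : ℕ, (R ^ (n : ℤ)) x ∈ C m) ∧ ∃ n : ℕ, (R ^ (-(n : ℤ))) x ∈ C m) ∧
      ∀ x ∉ Z, ∀ m N : ℕ,
        (∃ n ≥ N, (R ^ (n : ℤ)) x ∈ C m) ∧ ∃ n ≥ N, (R ^ (-(n : ℤ))) x ∈ C m := by
  obtain ⟨δ', hδ'0, hδ'⟩ := ENNReal.exists_pos_sum_of_countable' hδ ℕ
  have hC : ∀ m : ℕ, ∃ C : Set M, MeasurableSet C ∧ μ C < δ' m / (m + 1) ∧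
      univ \ Function.periodicPts R ⊆ orbitSaturation R C := by
    intro m
    -- The factor `1 / (m + 1)` pays for the `m + 1` iterates of `C m` put into `Z₁`.
    obtain ⟨C, -, hC, hCμ, -, hsat⟩ := exists_small_sweeping_subset hinv MeasurableSet.univ
      (δ := δ' m / (m + 1)) (ENNReal.div_ne_zero.2 ⟨(hδ'0 m).ne', by finiteness⟩)
    exact ⟨C, hC, hCμ, hsat⟩
  choose C hC hCμ hsat using hC
  have hae : ∀ᵐ x ∂μ, ∀ m N : ℕ,
      (∃ n ≥ N, (R ^ (n : ℤ)) x ∈ C m) ∧ ∃ n ≥ N, (R ^ (-(n : ℤ))) x ∈ C m := by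
    refine ae_all_iff.2 fun m => ?_
    filter_upwards [ae_forall_exists_ge_of_mem_orbitSaturation hinv (hC m),
      measure_eq_zero_iff_ae_notMem.1 haper] with x hx hxp
    exact hx (hsat m ⟨mem_univ x, hxp⟩)
  -- Deleting this null set turns almost sure recurrence into recurrence at every remaining point.
  let Z₀ : Set M := toMeasurable μ {x | ¬ ∀ m N : ℕ,
      (∃ n ≥ N, (R ^ (n : ℤ)) x ∈ C m) ∧ ∃ n ≥ N, (R ^ (-(n : ℤ))) x ∈ C m}
  have hZ₀ : μ Z₀ = 0 := (measure_toMeasurable _).trans (ae_iff.1 hae)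
  let Z₁ : Set M := ⋃ m : ℕ, ⋃ j ∈ Finset.range (m + 1), (R ^ (-(j : ℤ))) ⁻¹' C m
  have hZ₁ : μ Z₁ < δ := by
    refine (measure_iUnion_le _).trans_lt ((ENNReal.tsum_le_tsum fun m => ?_).trans_lt hδ')
    refine (measure_biUnion_finset_le _ _).trans ?_
    simp only [measure_zpow_preimage hinv, Finset.sum_const, nsmul_eq_mul, Finset.card_range,
      Nat.cast_add, Nat.cast_one]
    rw [mul_comm]
    exact (ENNReal.le_div_iff_mul_le (Or.inl (by positivity))
      (Or.inl (by finiteness))).1 (hCμ m).le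
  refine ⟨C, Z₁ ∪ Z₀, hC, ?_, ?_, ?_, ?_, ?_⟩
  · exact (MeasurableSet.iUnion fun m => .biUnion (Finset.countable_toSet _)
      fun j _ => measurable_zpow R _ (hC m)).union (measurableSet_toMeasurable _ _)
  · exact (measure_union_le _ _).trans_lt (by rwa [hZ₀, add_zero])
  · intro m x hx j hj
    refine Or.inl (mem_iUnion.2 ⟨m, mem_iUnion₂.2 ⟨j, by simpa [Nat.lt_succ_iff] using hj, ?_⟩⟩)
    rwa [mem_preimage, R.zpow_neg_zpow_apply]
  · intro m
    filter_upwards [hae] with x hx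
    obtain ⟨⟨n, -, hn⟩, ⟨k, -, hk⟩⟩ := hx m 0
    exact ⟨⟨n, hn⟩, ⟨k, hk⟩⟩
  · intro x hx
    by_contra hcon
    exact hx (Or.inr (subset_toMeasurable _ _ hcon))

/-- There is a set `Z` of small measure such that almost every point is accumulated by the visits
of its orbit to `Z`. -/
theorem exists_small_set_recurrent [T2Space M] [SecondCountableTopology M] [IsProbabilityMeasure μ]
    (hinv : MeasurePreserving R μ μ) (haper : μ (Function.periodicPts R) = 0)
    {δ : ℝ≥0∞} (hδ : δ ≠ 0) :
    ∃ Z : Set M, MeasurableSet Z ∧ μ Z < δ ∧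
      ∀ᵐ x ∂μ, ∀ V ∈ 𝓝 x, ∃ k : ℤ, (R ^ k) x ∈ V ∩ Z := by
  obtain ⟨b, hbc, -, hb⟩ := TopologicalSpace.exists_countable_basis M
  have : Countable b := hbc.to_subtype
  obtain ⟨δ', hδ'0, hδ'⟩ := ENNReal.exists_pos_sum_of_countable' hδ b
  -- The piece of `V` is small, yet the orbit of every non-periodic point of `V` visits it.
  have hC : ∀ V : b, ∃ C ⊆ V.1, MeasurableSet C ∧ μ C < δ' V ∧ (∀ x ∈ C, R x ∉ C) ∧
      V.1 \ Function.periodicPts R ⊆ orbitSaturation R C := fun V =>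
    exists_small_sweeping_subset hinv (hb.isOpen V.2).measurableSet (hδ'0 V).ne'
  choose C hCV hC hCμ _ hsat using hC
  refine ⟨⋃ V, C V, .iUnion hC, (measure_iUnion_le _).trans_lt
    ((ENNReal.tsum_le_tsum fun V => (hCμ V).le).trans_lt hδ'), ?_⟩
  filter_upwards [measure_eq_zero_iff_ae_notMem.1 haper] with x hx V hV
  obtain ⟨W, hW, hxW, hWV⟩ := hb.mem_nhds_iff.1 hV
  obtain ⟨k, hk⟩ := (mem_orbitSaturation_iff _ _ _).1 (hsat ⟨W, hW⟩ ⟨hxW, hx⟩)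
  exact ⟨k, hWV (hCV _ hk), mem_iUnion.2 ⟨_, hk⟩⟩

/-- Restricting to the support of the measure preserves coherence. -/
theorem exists_coherent_subset_support [SecondCountableTopology M]
    (hinv : MeasurePreserving R μ μ) {K : Set M} (hK : IsClosed K)
    (hcoh : ∀ k : ℤ, ∃ G : Set M, IsClosed G ∧ ∀ x ∈ K, x ∈ G ↔ (R ^ k) x ∉ K) :
    ∃ K' ⊆ K, IsClosed K' ∧ μ (K \ K') = 0 ∧ (∀ x ∈ K', ∀ U ∈ 𝓝 x, 0 < μ (U ∩ K')) ∧
      ∀ k : ℤ, ∃ G : Set M, IsClosed G ∧ ∀ x ∈ K', x ∈ G ↔ (R ^ k) x ∉ K' := by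
  let K' := K ∩ (μ.restrict K).support
  have hmem : ∀ x, x ∈ K' ↔ x ∈ K ∧ ∀ U ∈ 𝓝 x, 0 < μ (U ∩ K) := by
    intro x
    simp only [K', mem_inter_iff, Measure.mem_support_iff_forall,
      Measure.restrict_apply' hK.measurableSet]
  have hnull : μ (K \ K') = 0 := by
    have := Measure.measure_compl_support (μ := μ.restrict K)
    rw [Measure.restrict_apply' hK.measurableSet] at this
    refine measure_mono_null (fun x hx => ?_) this
    exact ⟨fun h => hx.2 ⟨hx.1, h⟩, hx.1⟩
  refine ⟨K', inter_subset_left, hK.inter Measure.isClosed_support, hnull, ?_, fun k => ?_⟩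
  · intro x hx U hU
    refine (((hmem x).1 hx).2 U hU).trans_le ?_
    calc μ (U ∩ K) ≤ μ (U ∩ K' ∪ K \ K') := by
          refine measure_mono fun y hy => ?_
          by_cases h : y ∈ K'
          · exact Or.inl ⟨hy.1, h⟩
          · exact Or.inr ⟨hy.2, h⟩
      _ ≤ μ (U ∩ K') + μ (K \ K') := measure_union_le _ _
      _ = μ (U ∩ K') := by rw [hnull, add_zero]
  · obtain ⟨G, hG, hGK⟩ := hcoh k
    refine ⟨G, hG, fun x hx => ?_⟩
    obtain ⟨hxK, hxU⟩ := (hmem x).1 hx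
    rw [hGK x hxK, not_iff_not]
    refine ⟨fun h => (hmem _).2 ⟨h, fun U hU => ?_⟩, fun h => h.1⟩
    -- Near `x`, all of `K` is sent into `K` by `R^k`, so positive mass around `x` is carried to
    -- positive mass around `R^k x`.
    have hxG : Gᶜ ∈ 𝓝 x := hG.isOpen_compl.mem_nhds fun h' => (hGK x hxK).1 h' h
    have hpos := hxU _ (inter_mem ((R ^ k).continuous.continuousAt.preimage_mem_nhds hU) hxG)
    rw [← measure_zpow_preimage hinv k (U ∩ K)]
    refine hpos.trans_le (measure_mono ?_)
    rintro y ⟨⟨hyU, hyG⟩, hyK⟩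
    exact ⟨hyU, not_not.1 fun hyn => hyG ((hGK y hyK).2 hyn)⟩

/-- Up to small measure, a compact manifold is at each scale contained in the interior of a finite
disjoint union of small rectangles. -/
theorem exists_small_set_compl_rectangles {d : ℕ} {M : Type*} [MetricSpace M] [MeasurableSpace M]
    [BorelSpace M] [CompactSpace M] [ChartedSpace (EuclideanSpace ℝ (Fin d)) M]
    (μ : Measure M) [IsFiniteMeasure μ] {δ : ℝ≥0∞} (hδ : δ ≠ 0) :
    ∃ Z : Set M, MeasurableSet Z ∧ μ Z < δ ∧ ∀ η > 0, ∃ E : Set (Set M), E.Finite ∧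
      (∀ X ∈ E, IsRectangle d X ∧ IsCompact X ∧ ∀ x ∈ X, ∀ y ∈ X, dist x y < η) ∧
      E.PairwiseDisjoint id ∧ Zᶜ ⊆ interior (⋃₀ E) := by
  obtain ⟨δ', hδ'0, hδ'⟩ := ENNReal.exists_pos_sum_of_countable' hδ ℕ
  have h : ∀ n : ℕ, ∃ E : Set (Set M), E.Finite ∧
      (∀ X ∈ E, IsRectangle d X ∧ IsCompact X ∧ ∀ x ∈ X, ∀ y ∈ X, dist x y < 1 / ((n : ℝ) + 1)) ∧
      E.PairwiseDisjoint id ∧ μ (interior (⋃₀ E))ᶜ < δ' n := fun n =>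
    exists_finite_rectangles μ (by positivity) (hδ'0 n).ne'
  choose E hEf hE hEd hEμ using h
  refine ⟨⋃ n, (interior (⋃₀ E n))ᶜ, .iUnion fun n => isOpen_interior.measurableSet.compl,
    (measure_iUnion_le _).trans_lt ((ENNReal.tsum_le_tsum fun n => (hEμ n).le).trans_lt hδ'), ?_⟩
  intro η hη
  obtain ⟨n, hn⟩ := exists_nat_one_div_lt hη
  refine ⟨E n, hEf n, fun X hX => ⟨(hE n X hX).1, (hE n X hX).2.1,
    fun x hx y hy => ((hE n X hX).2.2 x hx y hy).trans hn⟩, hEd n, ?_⟩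
  rw [compl_iUnion]
  exact (iInter_subset _ n).trans (compl_compl _).subset

end Construction

theorem propositionp (d : ℕ) {M : Type*} [TopologicalSpace M] [T2Space M] [CompactSpace M]
    [ChartedSpace (EuclideanSpace ℝ (Fin d)) M] [MeasurableSpace M] [BorelSpace M]
    (R : M ≃ₜ M) (μ : MeasureTheory.Measure M) [MeasureTheory.IsProbabilityMeasure μ]
    (hinv : MeasureTheory.MeasurePreserving R μ μ)
    (haper : μ (Function.periodicPts R) = 0)
    (A : Set M) (hA : MeasurableSet A) (hpos : 0 < μ A) :
    ∀ ε : ℝ, 0 < ε → ∃ K : Set M, IsCantorSet K ∧ K ⊆ A ∧ IsDynamicallyCoherent R K ∧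
      Disjoint K (R '' K) ∧ IsTamelyEmbedded d K ∧ IsDynamicallyMeagre R K ∧
      |μ.real (orbitSaturation R A) - μ.real (orbitSaturation R K)| < ε ∧ 0 < μ K := by
  intro ε hε
  have : SecondCountableTopology M :=
    ChartedSpace.secondCountable_of_sigmaCompact (EuclideanSpace ℝ (Fin d)) M
  let _ : MetricSpace M := TopologicalSpace.metrizableSpaceMetric M
  obtain ⟨A₀, hA₀A, hA₀, -, hA₀R, hA₀sat⟩ :=
    exists_small_sweeping_subset hinv hA (δ := 1) one_ne_zero
  have hsat₀ : μ (orbitSaturation R A \ orbitSaturation R A₀) = 0 := by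
    have hnull : μ (⋃ k : ℤ, (R ^ k) ⁻¹' Function.periodicPts R) = 0 :=
      measure_iUnion_null fun k => by rw [measure_zpow_preimage hinv, haper]
    refine measure_mono_null ?_ hnull
    rintro x ⟨hx, hx₀⟩
    obtain ⟨k, hk⟩ := (mem_orbitSaturation_iff _ _ _).1 hx
    refine mem_iUnion.2 ⟨k, by_contra fun hp => hx₀ ?_⟩
    exact (zpow_mem_orbitSaturation_iff _ _ k _).1 (hA₀sat ⟨hk, hp⟩)
  have hA₀pos : μ A₀ ≠ 0 := by
    intro h
    have h0 : μ (orbitSaturation R A₀) = 0 := by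
      refine measure_mono_null (fun x hx => ?_)
        (measure_iUnion_null fun k : ℤ => (measure_zpow_preimage hinv k A₀).trans h)
      exact mem_iUnion.2 ((mem_orbitSaturation_iff _ _ _).1 hx)
    refine hpos.ne' (measure_mono_null (fun x hx => ?_) (measure_union_null haper h0))
    by_cases hp : x ∈ Function.periodicPts R
    · exact Or.inl hp
    · exact Or.inr (hA₀sat ⟨hx, hp⟩)
  obtain ⟨δ₁, hδ₁, hδ₁sat⟩ := exists_forall_measure_orbitSaturation_diff_lt hinv hA₀
    (ENNReal.ofReal_pos.2 hε).ne'
  -- Losing less than `δ₁` controls the saturation; losing less than `μ A₀` leaves positive measure.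
  -- The four shares go to `Z₁`, `Z₂`, `Z₃` and `B \ L`.
  obtain ⟨δ, hδ0, hδ⟩ := ENNReal.exists_pos_sum_of_countable'
    (lt_min (pos_iff_ne_zero.2 hδ₁) (pos_iff_ne_zero.2 hA₀pos)).ne' (Fin 4)
  obtain ⟨C, Z₁, hC, hZ₁, hZ₁μ, hCZ₁, hvisit, hmarker⟩ := exists_markers hinv haper (hδ0 0).ne'
  obtain ⟨Z₂, hZ₂, hZ₂μ, hrec⟩ := exists_small_set_recurrent hinv haper (hδ0 1).ne'
  obtain ⟨Z₃, hZ₃, hZ₃μ, hrect⟩ := exists_small_set_compl_rectangles (d := d) μ (hδ0 2).ne'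
  let B : Set M := A₀ \ (Z₁ ∪ Z₂ ∪ Z₃)
  obtain ⟨L, hLB, hL, hLμ, hLcoh⟩ := exists_isClosed_coherent_subset hinv (B := B)
    (hA₀.diff ((hZ₁.union hZ₂).union hZ₃)) hC hvisit
    (fun m x hx j hj h => h.2 (Or.inl (Or.inl (hCZ₁ m x hx j hj)))) (hδ0 3).ne'
  obtain ⟨K, hKL, hK, hKμ, hKpos, hKcoh⟩ := exists_coherent_subset_support hinv hL hLcoh
  have hKB : K ⊆ B := hKL.trans hLB
  have hKA₀ : K ⊆ A₀ := hKB.trans sdiff_subset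
  have hKA : K ⊆ A := hKA₀.trans hA₀A
  have hKZ₁ : ∀ x ∈ K, x ∉ Z₁ := fun x hx h => (hKB hx).2 (Or.inl (Or.inl h))
  have hKZ₂ : ∀ x ∈ K, x ∉ Z₂ := fun x hx h => (hKB hx).2 (Or.inl (Or.inr h))
  have hKZ₃ : K ⊆ Z₃ᶜ := fun x hx h => (hKB hx).2 (Or.inr h)
  have hloss : μ (A₀ \ K) < min δ₁ (μ A₀) := by
    have hsub : A₀ \ K ⊆ Z₁ ∪ Z₂ ∪ Z₃ ∪ B \ L ∪ L \ K := by
      rintro x ⟨hx, hxK⟩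
      by_cases hxZ : x ∈ Z₁ ∪ Z₂ ∪ Z₃
      · exact Or.inl (Or.inl hxZ)
      · by_cases hxL : x ∈ L
        · exact Or.inr ⟨hxL, hxK⟩
        · exact Or.inl (Or.inr ⟨⟨hx, hxZ⟩, hxL⟩)
    refine lt_of_le_of_lt ?_ hδ
    rw [tsum_fintype, Fin.sum_univ_four]
    calc μ (A₀ \ K) ≤ μ (Z₁ ∪ Z₂ ∪ Z₃ ∪ B \ L ∪ L \ K) := measure_mono hsub
      _ ≤ μ (Z₁ ∪ Z₂ ∪ Z₃ ∪ B \ L) + μ (L \ K) := measure_union_le _ _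
      _ = μ (Z₁ ∪ Z₂ ∪ Z₃ ∪ B \ L) := by rw [hKμ, add_zero]
      _ ≤ μ Z₁ + μ Z₂ + μ Z₃ + μ (B \ L) :=
        (measure_union_le _ _).trans (add_le_add_left ((measure_union_le _ _).trans
          (add_le_add_left (measure_union_le _ _) _)) _)
      _ ≤ δ 0 + δ 1 + δ 2 + δ 3 := by gcongr
  have hKmeas : 0 < μ K := by
    refine pos_iff_ne_zero.2 fun h => ?_
    have := hloss.trans_le (min_le_right _ _)
    rw [measure_sdiff_null h] at this
    exact lt_irrefl _ this
  refine ⟨K, ⟨nonempty_of_measure_ne_zero hKmeas.ne', inferInstance, hK.isCompact, ?_, ?_⟩, hKA,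
    ⟨fun k => ?_, fun p x hx => ?_, fun p x hx => ?_⟩, ?_, ?_, ?_, ?_, hKmeas⟩
  · refine isTotallyDisconnected_of_forall_cover fun η hη => ?_
    obtain ⟨E, hEf, hE, hEd, hZE⟩ := hrect η hη
    exact ⟨E, hEf, fun X hX => (hE X hX).2, hEd, hKZ₃.trans (hZE.trans interior_subset)⟩
  · intro x hx
    refine accPt_iff_nhds.2 fun U hU => ?_
    by_contra! h
    exact (hKpos x hx U hU).ne' (measure_mono_null (fun y hy => h y hy)
      (measure_singleton_eq_zero_of_aperiodic hinv haper x))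
  · obtain ⟨G, hG, hGK⟩ := hKcoh (-k)
    convert hG.isOpen_compl.preimage (continuous_subtype_val (p := (· ∈ K))) using 1
    ext ⟨x, hx⟩
    rw [mem_preimage, mem_preimage, mem_compl_iff, hGK x hx, not_not, mem_inter_iff,
      R.mem_zpow_image_iff]
    exact and_iff_left hx
  · obtain ⟨⟨n, hn, hnC⟩, -⟩ := hmarker x (hKZ₁ x hx) p 1
    refine ⟨n, hn, fun j hj h => hKZ₁ _ h ?_⟩
    rw [add_comm, R.zpow_add_apply]
    exact hCZ₁ p _ hnC j hj
  -- The gap after the marker at time `-n` covers the times `-n` to `-n + p`; read backwards it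
  -- starts at `-(n - p)`, and `n ≥ p + 1` makes `n - p` positive.
  · obtain ⟨-, n, hn, hnC⟩ := hmarker x (hKZ₁ x hx) p (p + 1)
    refine ⟨n - p, by omega, fun j hj h => hKZ₁ _ h ?_⟩
    rw [show -((n - p : ℕ) : ℤ) - j = ((p - j : ℕ) : ℤ) + -n by omega, R.zpow_add_apply]
    exact hCZ₁ p _ hnC (p - j) (Nat.sub_le _ _)
  · refine disjoint_left.2 ?_
    rintro _ hx ⟨y, hy, rfl⟩
    exact hA₀R y (hKA₀ hy) (hKA₀ hx)
  · refine isTamelyEmbedded_of_forall_rectangles hK.isCompact fun η hη => ?_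
    obtain ⟨E, hEf, hE, hEd, hZE⟩ := hrect η hη
    exact ⟨E, hEf, hE, hEd, hKZ₃.trans hZE⟩
  · refine eq_empty_of_forall_notMem ?_
    rintro ⟨x, hxΛ⟩ hx
    obtain ⟨V, hV, hVK⟩ := mem_nhds_subtype _ _ _ |>.1 (mem_interior_iff_mem_nhds.1 hx)
    have hxK : (⟨x, hxΛ⟩ : closure (orbitSaturation R K)).1 ∈ K := mem_preimage.1 (interior_subset hx)
    obtain ⟨W, hWV, hW, hxW⟩ := mem_nhds_iff.1 hV
    -- As `W ∩ K` has positive measure, it contains a point `y` recurrent through `Z₂`: its orbit,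
    -- contained in `Λ`, enters `W ∩ Z₂`, thus leaves `K` inside `W`.
    obtain ⟨y, hy, hyrec⟩ := ((frequently_ae_mem_iff.2
      (hKpos x hxK W (hW.mem_nhds hxW)).ne').and_eventually hrec).exists
    obtain ⟨k, hkW, hkZ⟩ := hyrec W (hW.mem_nhds hy.1)
    refine hKZ₂ _ (hVK (?_ : (⟨(R ^ k) y, subset_closure ?_⟩ : closure (orbitSaturation R K)) ∈ _))
      hkZ
    · exact (mem_orbitSaturation_iff _ _ _).2 ⟨-k, by rw [R.zpow_neg_zpow_apply]; exact hy.2⟩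
    · exact hWV hkW
  · have hmono := orbitSaturation_mono R hKA
    rw [← measureReal_sdiff hmono hK.measurableSet.orbitSaturation, abs_of_nonneg measureReal_nonneg,
      measureReal_def]
    refine (ENNReal.lt_ofReal_iff_toReal_lt (measure_ne_top _ _)).1 ?_
    calc μ (orbitSaturation R A \ orbitSaturation R K)
        ≤ μ ((orbitSaturation R A \ orbitSaturation R A₀) ∪
            (orbitSaturation R A₀ \ orbitSaturation R K)) := by
          refine measure_mono fun x hx => ?_
          by_cases h : x ∈ orbitSaturation R A₀
          · exact Or.inr ⟨h, hx.2⟩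
          · exact Or.inl ⟨hx.1, h⟩
      _ ≤ _ := measure_union_le _ _
      _ < ENNReal.ofReal ε := by
          rw [hsat₀, zero_add]
          exact hδ₁sat K (hloss.trans_le (min_le_left _ _))
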